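/- Consider an instance of the Hospital Residents problem with lower and upper quotas. It consists of a finite set $R$ of residents and a finite set $H$ of hospitals; a symmetric acceptability relation between residents and hospitals; for every agent (resident or hospital) a strict ranking of all the agents it accepts; and for every hospital $h$ a lower quota $l(h)$ and an upper quota $u(h)$, which are integers with $1\le l(h)\le u(h)$. Every resident prefers each hospital she accepts to being unmatched. A matching is a set $M\subseteq R\times H$ of mutually acceptable pairs in which every resident occurs at most once. Write $M(h)=\{r\in R:(r,h)\in M\}$ for the set of residents matched to $h$. A hospital $h$ is open in $M$ if $M(h)\neq\emptyset$, and closed otherwise. The matching $M$ is feasible if for every hospital $h$ either $|M(h)|=0$ or $l(h)\le |M(h)|\le u(h)$. A pair $(r,h)$ of agents that accept each other is a blocking pair for $M$ if $h$ is open in $M$, $r$ prefers $h$ to her situation in $M$ (her hospital in $M$, or being unmatched), and either $|M(h)|<u(h)$ or $h$ prefers $r$ to at least one resident in $M(h)$. A blocking coalition for $M$ consists of a hospital $h$ that is closed in $M$ and a set of exactly $l(h)$ residents, each of whom prefers $h$ to her situation in $M$. A feasible matching is stable if it admits neither a blocking pair nor a blocking coalition. Suppose that $l(h)\le 2$ for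 every hospital $h$. Then any two stable matchings $M$ and $M'$ of the instance match the same set of residents, that is, $\{r : \exists h,\ (r,h)\in M\}=\{r : \exists h,\ (r,h)\in M'\}$, and open the same number of hospitals, that is, $|\{h : M(h)\ne\emptyset\}|=|\{h : M'(h)\neq\emptyset\}|$. -/

import Mathlib

/-- `IsStrictRanking A p`: the relation `p` ranks exactly the elements of `A` in strict order,
where `p a b` means that `a` is ranked above `b`. -/
structure IsStrictRanking {α : Type*} (A : Set α) (p : α → α → Prop) : Prop where
  mem : ∀ a b, p a b → a ∈ A ∧ b ∈ A
  irrefl : ∀ a, ¬ p a a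
  trans : ∀ a b c, p a b → p b c → p a c
  total : ∀ a ∈ A, ∀ b ∈ A, a ≠ b → p a b ∨ p b a

/-- An instance of the Hospital Residents problem with lower and upper quotas,
with residents `R` and hospitals `H`. -/
structure HRInstance (R H : Type*) where
  /-- the set of hospitals accepted by a resident -/
  accR : R → Set H
  /-- the set of residents accepted by a hospital -/
  accH : H → Set R
  /-- acceptability is symmetric -/
  acc_symm : ∀ r h, h ∈ accR r ↔ r ∈ accH h
  /-- `prefR r h h'`: resident `r` prefers hospital `h` to hospital `h'` -/
  prefR : R → H → H → Prop
  /-- `prefH h r r'`: hospital `h` prefers resident `r` to resident `r'` -/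
  prefH : H → R → R → Prop
  prefR_ranking : ∀ r, IsStrictRanking (accR r) (prefR r)
  prefH_ranking : ∀ h, IsStrictRanking (accH h) (prefH h)
  /-- lower quota -/
  lower : H → ℕ
  /-- upper quota -/
  upper : H → ℕ
  one_le_lower : ∀ h, 1 ≤ lower h
  lower_le_upper : ∀ h, lower h ≤ upper h

namespace HRInstance

variable {R H : Type*}

/-- The residents matched to hospital `h` in `M`. -/
def assigned (M : Set (R × H)) (h : H) : Set R := {r | (r, h) ∈ M}

/-- The residents that are matched to some hospital in `M`. -/
def matchedResidents (M : Set (R × H)) : Set R := {r | ∃ h, (r, h) ∈ M}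

/-- The hospitals that are open in `M`, i.e. to which at least one resident is matched;
all other hospitals are closed. -/
def openHospitals (M : Set (R × H)) : Set H := {h | (assigned M h).Nonempty}

variable (I : HRInstance R H)

/-- `M` is a matching: every resident is contained in at most one pair, and the agents of
every pair accept each other. -/
def IsMatching (M : Set (R × H)) : Prop :=
  (∀ r h h', (r, h) ∈ M → (r, h') ∈ M → h = h') ∧
    ∀ r h, (r, h) ∈ M → h ∈ I.accR r ∧ r ∈ I.accH h

/-- `M` is feasible: the number of residents matched to a hospital is zero or lies between
the lower and the upper quota of the hospital. -/
def IsFeasible (M : Set (R × H)) : Prop :=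
  ∀ h, (assigned M h).ncard = 0 ∨
    (I.lower h ≤ (assigned M h).ncard ∧ (assigned M h).ncard ≤ I.upper h)

/-- Resident `r` prefers hospital `h` to her situation in `M`: either she is matched to a
hospital that is worse for her than `h`, or she is unmatched and accepts `h`. -/
def PrefersToCurrent (M : Set (R × H)) (r : R) (h : H) : Prop :=
  (∃ h', (r, h') ∈ M ∧ I.prefR r h h') ∨ (r ∉ matchedResidents M ∧ h ∈ I.accR r)

/-- `(r, h)` is a blocking pair for `M`. -/
def IsBlockingPair (M : Set (R × H)) (r : R) (h : H) : Prop :=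
  h ∈ openHospitals M ∧ h ∈ I.accR r ∧ r ∈ I.accH h ∧ I.PrefersToCurrent M r h ∧
    ((assigned M h).ncard < I.upper h ∨ ∃ r' ∈ assigned M h, I.prefH h r r')

/-- The set `S` of residents is a blocking coalition for `M` that opens `h`. -/
def IsBlockingCoalition (M : Set (R × H)) (h : H) (S : Finset R) : Prop :=
  S.card = I.lower h ∧ h ∉ openHospitals M ∧ ∀ r ∈ S, I.PrefersToCurrent M r h

/-- `M` is a stable matching: a feasible matching that admits neither a blocking pair nor a
blocking coalition. -/
def IsStable (M : Set (R × H)) : Prop :=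
  I.IsMatching M ∧ I.IsFeasible M ∧ (∀ r h, ¬ I.IsBlockingPair M r h) ∧
    ∀ h S, ¬ I.IsBlockingCoalition M h S

end HRInstance

namespace HRInstance

/-! Let A be the residents better off in N, and B those better off in M. Every resident of A is
matched in N and every resident of B in M, so A ∪ B has |A| + |B| places at the preferred hospitals,
and at most that many at the other ones. Stability gives the opposite inequality hospital by
hospital (`IsStable.local_balance`); only here is l(h) ≤ 2 used. Hence equality holds everywhere:
all of A is matched in M and all of B in N, so nobody is matched in only one of the two. Equality at
a hospital also ties the change in its number of A-residents to its opening or closing; summed over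
the hospitals, the A-terms cancel and the open hospitals are equally many. -/

/-- The residents that are better off in `N` than in `M`, via their hospital in `N`. -/
def improvers {R H : Type*} (I : HRInstance R H) (M N : Set (R × H)) : Set R :=
  {r | ∃ h, (r, h) ∈ N ∧ I.PrefersToCurrent M r h}

/-- Double counting: in a matching, every matched resident of `S` is counted at exactly one
hospital. -/
theorem IsMatching.sum_ncard_assigned_inter {R H : Type*} [Finite R] [Fintype H]
    {I : HRInstance R H} {M : Set (R × H)} (hM : I.IsMatching M) (S : Set R) :
    ∑ h, (assigned M h ∩ S).ncard = (matchedResidents M ∩ S).ncard := by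
  classical
  have hU : matchedResidents M ∩ S = ⋃ h, (assigned M h ∩ S) := by
    ext r
    simp [matchedResidents, assigned]
  rw [hU, Set.ncard_iUnion_of_finite (fun h => Set.toFinite _), finsum_eq_sum_of_fintype]
  intro h h' hne
  refine Set.disjoint_left.2 fun r hr hr' => hne (hM.1 r h h' hr.1 hr'.1)

theorem improvers_subset_matchedResidents {R H : Type*} (I : HRInstance R H)
    (M N : Set (R × H)) : I.improvers M N ⊆ matchedResidents N :=
  fun _ ⟨h, hN, _⟩ => ⟨h, hN⟩

/-- In a matching, an improver at her hospital in `N` prefers that hospital to her situation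
in `M`. -/
theorem IsMatching.prefersToCurrent {R H : Type*} {I : HRInstance R H} {M N : Set (R × H)}
    (hN : I.IsMatching N) {r : R} {h : H} (hr : r ∈ assigned N h)
    (hi : r ∈ I.improvers M N) : I.PrefersToCurrent M r h := by
  obtain ⟨h', hN', hp⟩ := hi
  rwa [hN.1 r h h' hr hN']

theorem disjoint_improvers {R H : Type*} {I : HRInstance R H} {M N : Set (R × H)}
    (hM : I.IsMatching M) (hN : I.IsMatching N) :
    Disjoint (I.improvers M N) (I.improvers N M) := by
  refine Set.disjoint_left.2 ?_
  rintro r ⟨h, hrN, hp⟩ ⟨k, hrM, hq⟩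
  rcases hp with ⟨h', h1, h2⟩ | ⟨h1, -⟩
  · rcases hq with ⟨k', h3, h4⟩ | ⟨h3, -⟩
    · rw [hM.1 r h' k h1 hrM] at h2
      rw [hN.1 r k' h h3 hrN] at h4
      exact (I.prefR_ranking r).irrefl _ ((I.prefR_ranking r).trans _ _ _ h2 h4)
    · exact h3 ⟨h, hrN⟩
  · exact h1 ⟨k, hrM⟩

theorem IsMatching.notMem_improvers {R H : Type*} {I : HRInstance R H} {M N : Set (R × H)}
    (hM : I.IsMatching M) (hN : I.IsMatching N) {r : R} {h : H}
    (hrM : r ∈ assigned M h) (hrN : r ∈ assigned N h) : r ∉ I.improvers M N := by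
  intro hi
  rcases hN.prefersToCurrent hrN hi with ⟨h', h1, h2⟩ | ⟨h1, -⟩
  · rw [hM.1 r h' h h1 hrM] at h2
    exact (I.prefR_ranking r).irrefl _ h2
  · exact h1 ⟨h, hrM⟩

/-- A resident of `N(h)` is better off in `N`, better off in `M`, or also in `M(h)`. -/
theorem IsMatching.ncard_assigned_eq {R H : Type*} [Finite R] {I : HRInstance R H}
    {M N : Set (R × H)} (hM : I.IsMatching M) (hN : I.IsMatching N) (h : H) :
    (assigned N h).ncard = (assigned N h ∩ I.improvers M N).ncard +
      (assigned N h ∩ I.improvers N M).ncard + (assigned M h ∩ assigned N h).ncard := by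
  have hd := disjoint_improvers (I := I) hM hN
  rw [← Set.ncard_union_eq (hd.mono Set.inter_subset_right Set.inter_subset_right),
    ← Set.ncard_union_eq]
  · congr 1
    ext r
    constructor
    · intro hr
      by_cases hm : r ∈ matchedResidents M
      · obtain ⟨k, hk⟩ := hm
        by_cases hkh : k = h
        · subst hkh
          exact Or.inr ⟨hk, hr⟩
        · rcases (I.prefR_ranking r).total k (hM.2 r k hk).1 h (hN.2 r h hr).1 hkh with hp | hp
          · exact Or.inl (Or.inr ⟨hr, k, hk, Or.inl ⟨h, hr, hp⟩⟩)
          · exact Or.inl (Or.inl ⟨hr, h, hr, Or.inl ⟨k, hk, hp⟩⟩)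
      · exact Or.inl (Or.inl ⟨hr, h, hr, Or.inr ⟨hm, (hN.2 r h hr).1⟩⟩)
    · rintro ((hr | hr) | hr)
      exacts [hr.1, hr.1, hr.2]
  · refine Set.disjoint_left.2 ?_
    rintro r (hr | hr) hc
    · exact hM.notMem_improvers hN hc.1 hc.2 hr.2
    · exact hN.notMem_improvers hM hc.2 hc.1 hr.2

/-- If `h` is closed in a stable matching `M`, fewer than `l(h)` residents of `N(h)` are
better off in `N`. -/
theorem IsStable.ncard_improvers_lt_lower {R H : Type*} [Finite R] {I : HRInstance R H}
    {M N : Set (R × H)} (hM : I.IsStable M) (hN : I.IsMatching N) {h : H}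
    (hc : h ∉ openHospitals M) : (assigned N h ∩ I.improvers M N).ncard < I.lower h := by
  by_contra! hle
  obtain ⟨T, hT, hcard⟩ := Set.exists_subset_card_eq hle
  refine hM.2.2.2 h T.toFinite.toFinset ⟨?_, hc, fun r hr => ?_⟩
  · rw [← Set.ncard_eq_toFinset_card, hcard]
  · have := hT (by simpa using hr)
    exact hN.prefersToCurrent this.1 this.2

/-- If `h` is open in a stable matching `M` and `r ∈ N(h)` is better off in `N`, then `h` is
full in `M` and does not prefer `r` to any of its residents in `M`. -/
theorem IsStable.full_of_improver {R H : Type*} {I : HRInstance R H}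
    {M N : Set (R × H)} (hM : I.IsStable M) (hN : I.IsMatching N) {h : H}
    (ho : h ∈ openHospitals M) {r : R} (hr : r ∈ assigned N h ∩ I.improvers M N) :
    I.upper h ≤ (assigned M h).ncard ∧ ∀ r' ∈ assigned M h, ¬ I.prefH h r r' := by
  have hb := hM.2.2.1 r h
  have hacc := hN.2 r h hr.1
  have hp := hN.prefersToCurrent hr.1 hr.2
  refine ⟨?_, fun r' hr' hpr => hb ⟨ho, hacc.1, hacc.2, hp, Or.inr ⟨r', hr', hpr⟩⟩⟩
  by_contra! hlt
  exact hb ⟨ho, hacc.1, hacc.2, hp, Or.inl hlt⟩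

/-- At a hospital open in both stable matchings, the improvers of `N(h)` and those of `M(h)`
cannot both exist. -/
theorem IsStable.improvers_eq_zero {R H : Type*} [Finite R] {I : HRInstance R H}
    {M N : Set (R × H)} (hM : I.IsStable M) (hN : I.IsStable N) {h : H}
    (hoM : h ∈ openHospitals M) (hoN : h ∈ openHospitals N)
    (ha : (assigned N h ∩ I.improvers M N).ncard ≠ 0) :
    (assigned M h ∩ I.improvers N M).ncard = 0 ∧ I.upper h ≤ (assigned M h).ncard := by
  obtain ⟨r, hr⟩ := Set.nonempty_of_ncard_ne_zero ha
  have h1 := hM.full_of_improver hN.1 hoM hr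
  refine ⟨?_, h1.1⟩
  by_contra hb
  obtain ⟨s, hs⟩ := Set.nonempty_of_ncard_ne_zero hb
  have h2 := hN.full_of_improver hM.1 hoN hs
  have hne : r ≠ s := by
    rintro rfl
    exact Set.disjoint_left.1 (disjoint_improvers hM.1 hN.1) hr.2 hs.2
  -- If h ranks r above s, then (r, h) blocks M; otherwise (s, h) blocks N.
  rcases (I.prefH_ranking h).total r (hN.1.2 r h hr.1).2 s (hM.1.2 s h hs.1).2 hne with hp | hp
  · exact h1.2 s hs.1 hp
  · exact h2.2 r hr.1 hp

open Classical in
/-- At every hospital, the improvers of either matching gained there are at most as many as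
the residents whom it loses to improvements; in case of equality, the number of residents better
off in `N` changes between `M` and `N` exactly as the open status of the hospital does. -/
theorem IsStable.local_balance {R H : Type*} [Finite R] {I : HRInstance R H}
    (hlower : ∀ h, I.lower h ≤ 2) {M N : Set (R × H)} (hM : I.IsStable M) (hN : I.IsStable N)
    (h : H) :
    (assigned N h ∩ I.improvers M N).ncard + (assigned M h ∩ I.improvers N M).ncard ≤
        (assigned M h ∩ I.improvers M N).ncard + (assigned N h ∩ I.improvers N M).ncard ∧
      ((assigned N h ∩ I.improvers M N).ncard + (assigned M h ∩ I.improvers N M).ncard =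
        (assigned M h ∩ I.improvers M N).ncard + (assigned N h ∩ I.improvers N M).ncard →
      (assigned N h ∩ I.improvers M N).ncard + (if h ∈ openHospitals M then 1 else 0) =
        (assigned M h ∩ I.improvers M N).ncard + (if h ∈ openHospitals N then 1 else 0)) := by
  have hcN := hM.1.ncard_assigned_eq hN.1 h
  have hcM := hN.1.ncard_assigned_eq hM.1 h
  rw [Set.inter_comm (assigned N h) (assigned M h)] at hcM
  have hl := hlower h
  have hl1 := I.one_le_lower h
  have hfM := hM.2.1 h
  have hfN := hN.2.1 h
  have hopen : ∀ K : Set (R × H), h ∈ openHospitals K ↔ (assigned K h).ncard ≠ 0 := fun K => by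
    rw [Ne, Set.ncard_eq_zero, ← ne_eq, ← Set.nonempty_iff_ne_empty]
    rfl
  by_cases hoM : h ∈ openHospitals M <;> by_cases hoN : h ∈ openHospitals N
  -- If N(h) meets A, then M(h) avoids B and is full, so |N(h)| ≤ |M(h)|. Cancelling the common
  -- residents gives |N(h) ∩ A| + |N(h) ∩ B| ≤ |M(h) ∩ A|. The other case is symmetric.
  · have h1 := hM.improvers_eq_zero hN hoM hoN
    have h2 := hN.improvers_eq_zero hM hoN hoM
    have h3 := (hopen M).1 hoM
    have h4 := (hopen N).1 hoN
    simp only [hoM, hoN, if_true]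
    omega
  -- Here |M(h) ∩ B| ≤ l(h) - 1 ≤ 1, while |M(h)| ≥ l(h) forces |M(h) ∩ A| ≥ 1. Equality means that
  -- both are 1, which matches the single closure.
  · have h1 := hN.ncard_improvers_lt_lower hM.1 hoN
    have h3 := (hopen M).1 hoM
    have h4 := not_not.1 (mt (hopen N).2 hoN)
    simp only [hoM, hoN, if_true, if_false]
    omega
  · have h1 := hM.ncard_improvers_lt_lower hN.1 hoM
    have h3 := not_not.1 (mt (hopen M).2 hoM)
    have h4 := (hopen N).1 hoN
    simp only [hoM, hoN, if_true, if_false]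
    omega
  · have h3 := not_not.1 (mt (hopen M).2 hoM)
    have h4 := not_not.1 (mt (hopen N).2 hoN)
    simp only [hoM, hoN, if_false]
    omega

/-- If all residents better off in `N` are matched in `M`, every resident matched in `N` is
matched in `M`. -/
theorem IsMatching.matchedResidents_subset {R H : Type*} {I : HRInstance R H}
    {M N : Set (R × H)} (hN : I.IsMatching N)
    (hsub : I.improvers M N ⊆ matchedResidents M) :
    matchedResidents N ⊆ matchedResidents M := by
  rintro r ⟨h, hr⟩
  by_contra hm
  exact hm (hsub ⟨h, hr, Or.inr ⟨hm, (hN.2 r h hr).1⟩⟩)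

end HRInstance

open HRInstance in
theorem mainTheorem2 {R H : Type*} [Finite R] [Finite H] (I : HRInstance R H)
    (hlower : ∀ h, I.lower h ≤ 2) (M M' : Set (R × H))
    (hM : I.IsStable M) (hM' : I.IsStable M') :
    HRInstance.matchedResidents M = HRInstance.matchedResidents M' ∧
      (HRInstance.openHospitals M).ncard = (HRInstance.openHospitals M').ncard := by
  classical
  have := Fintype.ofFinite H
  have hbal := hM.local_balance hlower hM'
  have sa' := hM'.1.sum_ncard_assigned_inter (I.improvers M M')
  have sb := hM.1.sum_ncard_assigned_inter (I.improvers M' M)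
  have sa := hM.1.sum_ncard_assigned_inter (I.improvers M M')
  have sb' := hM'.1.sum_ncard_assigned_inter (I.improvers M' M)
  rw [Set.inter_eq_right.2 (I.improvers_subset_matchedResidents _ _)] at sa' sb
  have hA : (matchedResidents M ∩ I.improvers M M').ncard ≤ (I.improvers M M').ncard :=
    Set.ncard_le_ncard Set.inter_subset_right
  have hB : (matchedResidents M' ∩ I.improvers M' M).ncard ≤ (I.improvers M' M).ncard :=
    Set.ncard_le_ncard Set.inter_subset_right
  have hle := Finset.sum_le_sum fun h (_ : h ∈ Finset.univ) => (hbal h).1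
  -- The summed inequality is |A| + |B| ≤ |A matched in M| + |B matched in M'|, and `hA`, `hB` give
  -- the converse, so no hospital has slack.
  have heq := (Finset.sum_eq_sum_iff_of_le fun h (_ : h ∈ Finset.univ) => (hbal h).1).1
    (by simp only [Finset.sum_add_distrib] at hle ⊢; omega)
  have hopen := Finset.sum_congr rfl fun h hh => (hbal h).2 (heq h hh)
  simp only [Finset.sum_add_distrib] at hle hopen
  have hcount : ∀ K : Set (R × H),
      ∑ h, (if h ∈ openHospitals K then 1 else 0) = (openHospitals K).ncard := fun K => by
    rw [Finset.sum_boole, Set.ncard_eq_toFinset_card', Nat.cast_id]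
    congr 1
    ext h
    simp
  rw [hcount, hcount] at hopen
  refine ⟨Set.Subset.antisymm ?_ ?_, by omega⟩
  -- No slack in the sums also makes `hA` and `hB` equalities, so A lies inside the residents
  -- matched in M, and likewise B for M'.
  · refine hM.1.matchedResidents_subset (Set.inter_eq_right.1 ?_)
    exact Set.eq_of_subset_of_ncard_le Set.inter_subset_right (by omega)
  · refine hM'.1.matchedResidents_subset (Set.inter_eq_right.1 ?_)
    exact Set.eq_of_subset_of_ncard_le Set.inter_subset_right (by omega)
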